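/- **Setting.** Let $n\ge 1$, $m\ge 2$. Consider $x(k+1)=Ax(k)+w(k)$ in $\mathbb R^n$ and sensors $i=1,\dots,m$ with scalar measurements $y_i(k)=C_ix(k)+v_i(k)$; let $C$ be the matrix with rows $C_i$ and $v(k)=(v_1(k),\dots,v_m(k))^T$. Here $x(0)\sim\mathcal N(0,\Sigma)$, the $w(k)\sim\mathcal N(0,Q)$ are i.i.d., the $v(k)\sim\mathcal N(0,R)$ are i.i.d. ($\Sigma,Q,R\ge 0$), and $x(0)$, $\{w(k)\}$, $\{v(k)\}$ are independent. Assume that $(A,C)$ is observable. In suitable coordinates $A=\operatorname{diag}(A^u,A^s)$, where all eigenvalues of $A^u$ have modulus $\ge 1$ and all eigenvalues of $A^s$ have modulus $<1$. Let $P\ge 0$ be a steady-state Kalman prediction covariance, i.e. $CPC^T+R$ is invertible and $P=A(P-KCP)A^T+Q$ with the gain $K=PC^T(CPC^T+R)^{-1}=[K_1,\dots,K_m]$. Let $\mathbf 1\in\mathbb R^n$ be the all-ones vector. Let $\Lambda\in\mathbb R^{n\times n}$ have all its eigenvalues in the open unit disc and the same characteristic polynomial as $A-KCA$ (which is thus assumed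 strictly stable), and let $F_i\in\mathbb R^{n\times n}$ satisfy $F_i\Lambda=(A-KCA)F_i$ and $F_i\mathbf 1=K_i$. Let $0\ne\beta\in\mathbb R^n$ and $S=\Lambda+\mathbf 1\beta^T$ be such that $\det(sI-A^u)$ divides $\det(sI-S)$, the quotient has only roots of modulus $<1$, and $S$ and $\Lambda$ have no common eigenvalue. Let the sensors communicate over a connected undirected graph with weights $a_{ij}=a_{ji}\ge 0$ (with an edge between $i\neq j$ iff $a_{ij}>0$), whose Laplacian has the eigenvalues $0=\mu_1<\mu_2\le\dots\le\mu_m$. **Algorithm 1.** With $\hat\xi_i(0)=0$ and $\eta_{i,j}(0)=0\in\mathbb R^n$, each sensor $i$ computes, for $k\ge 0$ and $j=1,\dots,m$, $$z_i(k)=y_i(k+1)-\beta^T\hat\xi_i(k),\qquad \hat\xi_i(k+1)=S\hat\xi_i(k)+\mathbf 1z_i(k),$$ $$\eta_{i,j}(k+1)=S\eta_{i,j}(k)+\delta_{ij}\mathbf 1z_i(k)+\mathbf 1\sum_{l=1}^m a_{il}\,\Gamma\bigl(\eta_{l,j}(k)-\eta_{i,j}(k)\bigr),$$ where $\delta_{ij}$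 is the Kronecker delta and $\Gamma\in\mathbb R^{1\times n}$, and its estimate of $x(k)$ is $\breve x_i(k)=m\sum_{j=1}^mF_j\eta_{i,j}(k)$. **Theorem.** Let $M(S)$ be the product of the moduli of the eigenvalues of $S$ of modulus $\ge 1$, counted with multiplicity (the empty product being $1$), and suppose that $$M(S)<\frac{1+\mu_2/\mu_m}{1-\mu_2/\mu_m},$$ where the right-hand side is $+\infty$ if $\mu_2=\mu_m$. Let $\zeta$ satisfy $M(S)<\zeta^{-1}\le\frac{1+\mu_2/\mu_m}{1-\mu_2/\mu_m}$, let $\mathcal P>0$ be a (symmetric) solution of the modified algebraic Riccati inequality $$\mathcal P-S^T\mathcal PS+(1-\zeta^2)\frac{S^T\mathcal P\mathbf 1\mathbf 1^T\mathcal PS}{\mathbf 1^T\mathcal P\mathbf 1}>0,$$ and let $$\Gamma=\frac{2}{\mu_2+\mu_m}\,\frac{\mathbf 1^T\mathcal PS}{\mathbf 1^T\mathcal P\mathbf 1}.$$ Then, under Algorithm 1, for every sensor $i$ the error $\breve x_i(k)-x(k)$ is square integrable for all $k\ge 0$, and its covariance matrix is bounded uniformly in $k\ge 0$. -/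

import Mathlib

open MeasureTheory ProbabilityTheory Matrix Polynomial

noncomputable section

namespace DKF

/-- Complex eigenvalues of a real matrix, listed with algebraic multiplicity. -/
def eigs {ι : Type*} [Fintype ι] [DecidableEq ι] (M : Matrix ι ι ℝ) : Multiset ℂ :=
  (M.charpoly.map (algebraMap ℝ ℂ)).roots

/-- Strict (Schur) stability: every eigenvalue lies in the open unit disc. -/
def IsSchur {ι : Type*} [Fintype ι] [DecidableEq ι] (M : Matrix ι ι ℝ) : Prop :=
  ∀ z ∈ eigs M, ‖z‖ < 1

/-- The product of the moduli of the unstable eigenvalues (those of modulus at least one),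
counted with multiplicity. -/
def unstableProd {ι : Type*} [Fintype ι] [DecidableEq ι] (M : Matrix ι ι ℝ) : ℝ :=
  (((eigs M).filter (fun z => 1 ≤ ‖z‖)).map (fun z => ‖z‖)).prod

/-- Observability of the pair `(A, C)`. -/
def Observable {n m : ℕ} (A : Matrix (Fin n) (Fin n) ℝ) (C : Matrix (Fin m) (Fin n) ℝ) : Prop :=
  ∀ x : Fin n → ℝ, (∀ k : ℕ, C *ᵥ ((A ^ k) *ᵥ x) = 0) → x = 0

/-- In suitable coordinates `A` is `diag(Au, As)`, where the eigenvalues of `Au` lie on or outside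
the unit circle and those of `As` strictly inside it. -/
structure IsSplit {n nu ns : ℕ} (A : Matrix (Fin n) (Fin n) ℝ)
    (Au : Matrix (Fin nu) (Fin nu) ℝ) (As : Matrix (Fin ns) (Fin ns) ℝ) : Prop where
  similar : ∃ (T : Matrix (Fin n) (Fin nu ⊕ Fin ns) ℝ) (T' : Matrix (Fin nu ⊕ Fin ns) (Fin n) ℝ),
    T * T' = 1 ∧ T' * T = 1 ∧ A = T * Matrix.fromBlocks Au 0 0 As * T'
  unstable : ∀ z ∈ eigs Au, 1 ≤ ‖z‖
  stable : IsSchur As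

/-! ### Plant, measurements and the steady-state Kalman gain -/

/-- `x(k+1) = A x(k) + w(k)`. -/
def state {n : ℕ} (A : Matrix (Fin n) (Fin n) ℝ) (x0 : Fin n → ℝ) (w : ℕ → Fin n → ℝ) :
    ℕ → Fin n → ℝ
  | 0 => x0
  | k + 1 => A *ᵥ state A x0 w k + w k

/-- `y(k) = C x(k) + v(k)`; the `i`-th entry is the measurement of sensor `i`. -/
def output {n m : ℕ} (A : Matrix (Fin n) (Fin n) ℝ) (C : Matrix (Fin m) (Fin n) ℝ)
    (x0 : Fin n → ℝ) (w : ℕ → Fin n → ℝ) (v : ℕ → Fin m → ℝ) (k : ℕ) : Fin m → ℝ :=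
  C *ᵥ state A x0 w k + v k

/-- Law and independence of the initial state and of the noises: `x(0) ∼ N(0, Sig)`, the `w(k)` are
i.i.d. `N(0, Q)`, the `v(k)` are i.i.d. `N(0, R)`, and `x(0)`, `w`, `v` are independent. -/
structure IsGaussianModel {Ω : Type*} [MeasurableSpace Ω] (μ : Measure Ω) {n m : ℕ}
    (Sig Q : Matrix (Fin n) (Fin n) ℝ) (R : Matrix (Fin m) (Fin m) ℝ)
    (x0 : Ω → Fin n → ℝ) (w : ℕ → Ω → Fin n → ℝ) (v : ℕ → Ω → Fin m → ℝ) : Prop where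
  sig_psd : Sig.PosSemidef
  q_psd : Q.PosSemidef
  r_psd : R.PosSemidef
  law_x0 : HasLaw (fun ω => WithLp.toLp 2 (x0 ω)) (multivariateGaussian 0 Sig) μ
  law_w : ∀ k, HasLaw (fun ω => WithLp.toLp 2 (w k ω)) (multivariateGaussian 0 Q) μ
  law_v : ∀ k, HasLaw (fun ω => WithLp.toLp 2 (v k ω)) (multivariateGaussian 0 R) μ
  indep_w : iIndepFun w μ
  indep_v : iIndepFun v μ
  indep_x0_w : IndepFun x0 (fun ω k => w k ω) μ
  indep_v_rest : IndepFun (fun ω k => v k ω) (fun ω => (x0 ω, fun k => w k ω)) μ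

/-- `K = P Cᵀ (C P Cᵀ + R)⁻¹`. -/
def kalmanGain {n m : ℕ} (C : Matrix (Fin m) (Fin n) ℝ) (R : Matrix (Fin m) (Fin m) ℝ)
    (P : Matrix (Fin n) (Fin n) ℝ) : Matrix (Fin n) (Fin m) ℝ :=
  P * Cᵀ * (C * P * Cᵀ + R)⁻¹

/-- `P` is a steady state of the (one-step prediction) error covariance of the Kalman filter:
a positive semidefinite fixed point of the Riccati recursion. -/
structure IsSteadyState {n m : ℕ} (A : Matrix (Fin n) (Fin n) ℝ) (C : Matrix (Fin m) (Fin n) ℝ)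
    (Q : Matrix (Fin n) (Fin n) ℝ) (R : Matrix (Fin m) (Fin m) ℝ)
    (P : Matrix (Fin n) (Fin n) ℝ) : Prop where
  psd : P.PosSemidef
  innovation : IsUnit (C * P * Cᵀ + R)
  fixed : P = A * (P - kalmanGain C R P * C * P) * Aᵀ + Q

/-! ### Local decomposition of the Kalman filter -/

/-- `S = Λ + 1 βᵀ`. -/
def sMatrix {n : ℕ} (Lam : Matrix (Fin n) (Fin n) ℝ) (β : Fin n → ℝ) : Matrix (Fin n) (Fin n) ℝ :=
  Lam + vecMulVec 1 β

/-- Admissible choice of `Λ`, `β` and `F₁, …, F_m` for the closed-loop matrix `A - K C A`. -/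
structure IsDecomposition {n m nu : ℕ} (A : Matrix (Fin n) (Fin n) ℝ)
    (Au : Matrix (Fin nu) (Fin nu) ℝ) (C : Matrix (Fin m) (Fin n) ℝ) (K : Matrix (Fin n) (Fin m) ℝ)
    (Lam : Matrix (Fin n) (Fin n) ℝ) (β : Fin n → ℝ)
    (F : Fin m → Matrix (Fin n) (Fin n) ℝ) : Prop where
  lam_schur : IsSchur Lam
  lam_charpoly : Lam.charpoly = (A - K * C * A).charpoly
  f_intertwine : ∀ i, F i * Lam = (A - K * C * A) * F i
  f_one : ∀ i, F i *ᵥ 1 = fun p => K p i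
  beta_ne : β ≠ 0
  s_charpoly : ∃ q : ℝ[X], (sMatrix Lam β).charpoly = Au.charpoly * q ∧
    ∀ z : ℂ, aeval z q = 0 → ‖z‖ < 1
  s_disjoint : ∀ z ∈ eigs (sMatrix Lam β), z ∉ eigs Lam

/-! ### Communication network -/

/-- A weighted undirected graph on the sensors `0, …, m - 1`. -/
structure WeightedGraph (m : ℕ) where
  adj : Matrix (Fin m) (Fin m) ℝ
  symm : ∀ i j, adj i j = adj j i
  nonneg : ∀ i j, 0 ≤ adj i j

namespace WeightedGraph

variable {m : ℕ} (G : WeightedGraph m)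

/-- Two distinct sensors are neighbours iff their weight is positive. -/
def toSimpleGraph : SimpleGraph (Fin m) :=
  SimpleGraph.fromRel (fun i j => 0 < G.adj i j)

/-- The Laplacian matrix, degree matrix minus adjacency matrix. -/
def laplacian : Matrix (Fin m) (Fin m) ℝ :=
  Matrix.diagonal (fun i => ∑ j, G.adj i j) - G.adj

theorem laplacian_isHermitian : G.laplacian.IsHermitian := by
  have h : G.adj.IsHermitian := by
    ext i j
    simp [Matrix.conjTranspose_apply, G.symm i j]
  exact (Matrix.isHermitian_diagonal _).sub h

/-- The eigenvalues of the Laplacian with multiplicity, in increasing order. -/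
def lapEig (i : Fin m) : ℝ :=
  G.laplacian_isHermitian.eigenvalues₀ (Fin.cast (Fintype.card_fin m).symm i.rev)

/-- The second smallest Laplacian eigenvalue. -/
def μ₂ (hm : 2 ≤ m) : ℝ := G.lapEig ⟨1, by omega⟩

/-- The largest Laplacian eigenvalue. -/
def μₘ (hm : 2 ≤ m) : ℝ := G.lapEig ⟨m - 1, by omega⟩

open scoped ENNReal in
/-- `(1 + μ₂/μₘ) / (1 - μ₂/μₘ)`, equal to `∞` if `μ₂ = μₘ`. -/
def eigenratioBound (hm : 2 ≤ m) : ℝ≥0∞ :=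
  ENNReal.ofReal (1 + G.μ₂ hm / G.μₘ hm) / ENNReal.ofReal (1 - G.μ₂ hm / G.μₘ hm)

end WeightedGraph

/-! ### Consensus gain -/

/-- The modified algebraic Riccati inequality
`Pc - Sᵀ Pc S + (1 - ζ²) Sᵀ Pc 1 1ᵀ Pc S / (1ᵀ Pc 1) > 0` with `Pc > 0`. -/
def RiccatiInequality {n : ℕ} (S Pc : Matrix (Fin n) (Fin n) ℝ) (ζ : ℝ) : Prop :=
  Pc.PosDef ∧
  (Pc - Sᵀ * Pc * S + ((1 - ζ ^ 2) / ((1 : Fin n → ℝ) ⬝ᵥ Pc *ᵥ 1)) •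
    vecMulVec ((Sᵀ * Pc) *ᵥ 1) (1 ᵥ* (Pc * S))).PosDef

/-- The row vector `Γ = 2/(μ₂ + μₘ) · 1ᵀ Pc S / (1ᵀ Pc 1)`. -/
def consensusGain {n : ℕ} (S Pc : Matrix (Fin n) (Fin n) ℝ) (μ₂ μₘ : ℝ) : Fin n → ℝ :=
  (2 / (μ₂ + μₘ) / ((1 : Fin n → ℝ) ⬝ᵥ Pc *ᵥ 1)) • (1 ᵥ* (Pc * S))

/-! ### The distributed estimation algorithm -/

section Algorithm

variable {n m : ℕ}

/-- Local estimates: `ξ̂ᵢ(0) = 0` and `ξ̂ᵢ(k+1) = S ξ̂ᵢ(k) + 1 zᵢ(k)` with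
`zᵢ(k) = yᵢ(k+1) - βᵀ ξ̂ᵢ(k)`. -/
def localEst (S : Matrix (Fin n) (Fin n) ℝ) (β : Fin n → ℝ) (y : ℕ → Fin m → ℝ) :
    ℕ → Fin m → Fin n → ℝ
  | 0 => 0
  | k + 1 => fun i => S *ᵥ localEst S β y k i + (y (k + 1) i - β ⬝ᵥ localEst S β y k i) • 1

/-- The local residual `zᵢ(k)`. -/
def residual (S : Matrix (Fin n) (Fin n) ℝ) (β : Fin n → ℝ) (y : ℕ → Fin m → ℝ)
    (k : ℕ) (i : Fin m) : ℝ :=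
  y (k + 1) i - β ⬝ᵥ localEst S β y k i

/-- The message `Δ = (I_m ⊗ Γ) η`, whose `j`-th entry is `Γ η_j`. -/
def message (Γ : Fin n → ℝ) (η : Fin m → Fin n → ℝ) : Fin m → ℝ := fun j => Γ ⬝ᵥ η j

/-- The consensus states, `consensus … k i j` being the block `η_{i,j}(k) ∈ ℝⁿ` of `ηᵢ(k) ∈ ℝ^{mn}`:
`ηᵢ(0) = 0` and
`ηᵢ(k+1) = (I_m ⊗ S) ηᵢ(k) + (eᵢ ⊗ 1) zᵢ(k) + (I_m ⊗ 1) ∑ₗ a_{il} (Δₗ(k) - Δᵢ(k))`. -/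
def consensus (G : WeightedGraph m) (S : Matrix (Fin n) (Fin n) ℝ) (β Γ : Fin n → ℝ)
    (y : ℕ → Fin m → ℝ) : ℕ → Fin m → Fin m → Fin n → ℝ
  | 0 => 0
  | k + 1 => fun i j =>
      S *ᵥ consensus G S β Γ y k i j
      + (if j = i then residual S β y k i else 0) • 1
      + (∑ l, G.adj i l * (message Γ (consensus G S β Γ y k l) j
          - message Γ (consensus G S β Γ y k i) j)) • 1

/-- The fused estimate `x̆ᵢ(k) = m F ηᵢ(k)` with `F = [F₁, …, F_m]`. -/
def fusedEst (G : WeightedGraph m) (S : Matrix (Fin n) (Fin n) ℝ) (β Γ : Fin n → ℝ)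
    (F : Fin m → Matrix (Fin n) (Fin n) ℝ) (y : ℕ → Fin m → ℝ) (k : ℕ) (i : Fin m) : Fin n → ℝ :=
  (m : ℝ) • ∑ j, F j *ᵥ consensus G S β Γ y k i j

end Algorithm

/-- The random estimation error `x̆ᵢ(k) - x(k)`. -/
def estError {Ω : Type*} {n m : ℕ} (A : Matrix (Fin n) (Fin n) ℝ) (C : Matrix (Fin m) (Fin n) ℝ)
    (x0 : Ω → Fin n → ℝ) (w : ℕ → Ω → Fin n → ℝ) (v : ℕ → Ω → Fin m → ℝ)
    (G : WeightedGraph m) (S : Matrix (Fin n) (Fin n) ℝ) (β Γ : Fin n → ℝ)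
    (F : Fin m → Matrix (Fin n) (Fin n) ℝ) (i : Fin m) (k : ℕ) (ω : Ω) : Fin n → ℝ :=
  fusedEst G S β Γ F (output A C (x0 ω) (fun t => w t ω) (fun t => v t ω)) k i
    - state A (x0 ω) (fun t => w t ω) k

/-- The covariance matrix of a random vector. -/
def covMatrix {Ω : Type*} [MeasurableSpace Ω] (μ : Measure Ω) {n : ℕ} (X : Ω → Fin n → ℝ) :
    Matrix (Fin n) (Fin n) ℝ :=
  Matrix.of fun p q => covariance (fun ω => X ω p) (fun ω => X ω q) μ

/-- A sequence of random vectors is stable: all of them are square integrable, and the entries of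
their covariance matrices are bounded uniformly in time. -/
def IsStableSignal {Ω : Type*} [MeasurableSpace Ω] (μ : Measure Ω) {n : ℕ}
    (X : ℕ → Ω → Fin n → ℝ) : Prop :=
  (∀ k p, MemLp (fun ω => X k ω p) 2 μ) ∧ ∃ M : ℝ, ∀ k p q, |covMatrix μ (X k) p q| ≤ M

end DKF

end

noncomputable section

namespace DKF

open scoped NNReal ENNReal

/-! ### Schur stability -/

section Schur

variable {ι : Type*} [Fintype ι] [DecidableEq ι]

/-! The error of sensor `i` splits as `∑ⱼ Fⱼ (m ηᵢⱼ - ξ̂ⱼ) + (∑ⱼ Fⱼ ξ̂ⱼ - x)`. A Schur stable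
recursion driven by an input with bounded `L²` norms keeps those norms bounded
(`VecBddL2.of_recursion`), so it suffices to find stable recursions for both terms. The second term
is the error of the steady-state Kalman filter, which evolves with `A - KCA`. For the first, `∑ᵢ ηᵢⱼ
= ξ̂ⱼ` because the Laplacian annihilates `1`. Along an eigenvector with eigenvalue `μ`, the
consensus states evolve with `S - μ 1Γ`, driven by `zⱼ`. Modes with `μ = 0` are constant over a
connected graph and cancel in the disagreement. For the others `|1 - 2μ/(μ₂+μₘ)| ≤ ζ`, so the
Riccati inequality makes `Pc` a Lyapunov matrix (`isSchur_sub_consensusGain`). What remains is that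
`zⱼ` is bounded although `x` may diverge (`bddL2_residual`): `S` contains the unstable modes of `A`,
so `βᵀξ̂ⱼ` tracks the unstable part of `yⱼ`. Algebraically, a matrix `T` built from the adjugate of
`XI - Λ` makes `ξ̂ⱼ - T x` bounded, and what is left of `zⱼ` depends on `x` only through `χ_{Au}(A)
x`, which is bounded by Cayley-Hamilton. -/

theorem mem_eigs_iff {M : Matrix ι ι ℝ} {z : ℂ} : z ∈ eigs M ↔ aeval z M.charpoly = 0 := by
  rw [eigs, mem_roots ((M.charpoly_monic.map _).ne_zero), IsRoot.def, eval_map_algebraMap]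

theorem IsSchur.congr_charpoly {M N : Matrix ι ι ℝ} (h : IsSchur M) (hc : M.charpoly = N.charpoly) :
    IsSchur N := by
  intro z hz
  apply h z
  rwa [eigs, hc]

attribute [local instance] Matrix.linftyOpNormedRing Matrix.linftyOpNormedAlgebra in
theorem norm_entry_le_linftyOp (M : Matrix ι ι ℂ) (p q : ι) : ‖M p q‖ ≤ ‖M‖ := by
  rw [Matrix.linfty_opNorm_def, ← coe_nnnorm, NNReal.coe_le_coe]
  exact (Finset.single_le_sum (f := fun j => ‖M p j‖₊) (fun _ _ => zero_le) (Finset.mem_univ q)).trans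
    (Finset.le_sup (f := fun i => ∑ j, ‖M i j‖₊) (Finset.mem_univ p))

attribute [local instance] Matrix.linftyOpNormedRing Matrix.linftyOpNormedAlgebra in
/-- The powers of a Schur stable matrix are absolutely summable. -/
theorem IsSchur.tsum_enorm_pow_ne_top {M : Matrix ι ι ℝ} (h : IsSchur M) (p q : ι) :
    ∑' k : ℕ, ‖(M ^ k) p q‖ₑ ≠ ∞ := by
  have : Nonempty ι := ⟨p⟩
  set B : Matrix ι ι ℂ := M.map (algebraMap ℝ ℂ) with hB
  have hspec : ∀ z ∈ spectrum ℂ B, ‖z‖₊ < 1 := by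
    intro z hz
    rw [Matrix.mem_spectrum_iff_isRoot_charpoly, hB, Matrix.charpoly_map, IsRoot.def,
      eval_map_algebraMap, ← mem_eigs_iff] at hz
    exact_mod_cast h z hz
  have hrad : spectralRadius ℂ B < ((1 : ℝ≥0) : ℝ≥0∞) :=
    spectrum.spectralRadius_lt_of_forall_lt B hspec
  obtain ⟨r, hr1, hr2⟩ := ENNReal.lt_iff_exists_nnreal_btwn.1 hrad
  -- Gelfand's formula: eventually `‖B ^ k‖ ≤ r ^ k`, with `r < 1` chosen above the spectral radius.
  have hlim := (spectrum.pow_nnnorm_pow_one_div_tendsto_nhds_spectralRadius B).eventually_lt_const hr1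
  have hr2' : (r : ℝ) < 1 := by exact_mod_cast hr2
  have hsum : Summable (fun k : ℕ => ‖(M ^ k) p q‖₊) := by
    rw [← NNReal.summable_coe]
    refine Summable.of_norm_bounded_eventually_nat (summable_geometric_of_lt_one r.2 hr2') ?_
    filter_upwards [hlim, Filter.eventually_gt_atTop 0] with k hk hk0
    have hk0' : (0 : ℝ) < k := by exact_mod_cast hk0
    have h1 : (‖B ^ k‖₊ : ℝ≥0∞) ≤ (r : ℝ≥0∞) ^ k := by
      have := ENNReal.rpow_le_rpow hk.le hk0'.le
      rw [← ENNReal.rpow_mul, one_div, inv_mul_cancel₀ hk0'.ne', ENNReal.rpow_one,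
        ENNReal.rpow_natCast] at this
      exact this
    have h2 : ‖B ^ k‖ ≤ (r : ℝ) ^ k := by exact_mod_cast h1
    have h3 : (B ^ k) p q = (((M ^ k) p q : ℝ) : ℂ) := by
      rw [hB, ← Matrix.map_pow]; rfl
    have h4 := norm_entry_le_linftyOp (B ^ k) p q
    rw [h3, Complex.norm_real] at h4
    simpa using h4.trans h2
  exact ENNReal.tsum_coe_ne_top_iff_summable.2 hsum

end Schur

/-! ### Signals bounded in `L²` -/

section Bounded

variable {Ω : Type*} [MeasurableSpace Ω] {μ : Measure Ω}

/-- A scalar random signal whose `L²` norm is bounded uniformly in time. -/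
def BddL2 (μ : Measure Ω) (u : ℕ → Ω → ℝ) : Prop :=
  (∀ k, MemLp (u k) 2 μ) ∧ ∃ B : ℝ≥0, ∀ k, eLpNorm (u k) 2 μ ≤ B

/-- A random vector signal whose entries are bounded in `L²` uniformly in time. -/
def VecBddL2 {ι : Type*} (μ : Measure Ω) (u : ℕ → Ω → ι → ℝ) : Prop :=
  ∀ p, BddL2 μ (fun k ω => u k ω p)

namespace BddL2

variable {u v : ℕ → Ω → ℝ}

theorem add (hu : BddL2 μ u) (hv : BddL2 μ v) : BddL2 μ (fun k ω => u k ω + v k ω) := by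
  obtain ⟨hu, B, hB⟩ := hu
  obtain ⟨hv, D, hD⟩ := hv
  refine ⟨fun k => (hu k).add (hv k), B + D, fun k => ?_⟩
  rw [ENNReal.coe_add]
  exact (eLpNorm_add_le (hu k).1 (hv k).1 (by norm_num)).trans (add_le_add (hB k) (hD k))

theorem const_mul (hu : BddL2 μ u) (c : ℝ) : BddL2 μ (fun k ω => c * u k ω) := by
  obtain ⟨hu, B, hB⟩ := hu
  refine ⟨fun k => (hu k).const_mul c, ‖c‖₊ * B, fun k => ?_⟩
  have := eLpNorm_const_smul c (u k) 2 μ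
  rw [ENNReal.coe_mul]
  exact this.le.trans (mul_le_mul_right (hB k) _)

theorem zero : BddL2 μ (fun _ _ => 0) :=
  ⟨fun _ => MemLp.zero, 0, fun _ => by simp⟩

theorem neg (hu : BddL2 μ u) : BddL2 μ (fun k ω => -u k ω) := by
  simpa using hu.const_mul (-1)

theorem sub (hu : BddL2 μ u) (hv : BddL2 μ v) : BddL2 μ (fun k ω => u k ω - v k ω) := by
  simpa [sub_eq_add_neg] using hu.add hv.neg

theorem sum {κ : Type*} (s : Finset κ) {f : κ → ℕ → Ω → ℝ} (hf : ∀ i ∈ s, BddL2 μ (f i)) :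
    BddL2 μ (fun k ω => ∑ i ∈ s, f i k ω) := by
  classical
  induction s using Finset.induction_on with
  | empty => simpa using zero
  | insert a s ha ih =>
    simp only [Finset.sum_insert ha]
    exact (hf a (Finset.mem_insert_self a s)).add
      (ih fun i hi => hf i (Finset.mem_insert_of_mem hi))

theorem shift (hu : BddL2 μ u) : BddL2 μ (fun k => u (k + 1)) :=
  ⟨fun k => hu.1 (k + 1), hu.2.choose, fun k => hu.2.choose_spec (k + 1)⟩

theorem exists_integral_sq_le (hu : BddL2 μ u) : ∃ M : ℝ, ∀ k, ∫ ω, u k ω ^ 2 ∂μ ≤ M := by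
  obtain ⟨hu, B, hB⟩ := hu
  refine ⟨(B : ℝ) ^ 2, fun k => ?_⟩
  have h1 := (hu k).eLpNorm_eq_integral_rpow_norm two_ne_zero ENNReal.ofNat_ne_top
  have h2 := hB k
  rw [h1, ENNReal.ofReal_le_iff_le_toReal ENNReal.coe_ne_top] at h2
  simp only [ENNReal.toReal_ofNat, Real.rpow_ofNat, Real.norm_eq_abs, sq_abs,
    ENNReal.coe_toReal] at h2
  have h0 : 0 ≤ ∫ ω, u k ω ^ 2 ∂μ := integral_nonneg fun _ => sq_nonneg _
  have h3 := pow_le_pow_left₀ (Real.rpow_nonneg h0 _) h2 2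
  rwa [← Real.rpow_natCast, ← Real.rpow_mul h0, Nat.cast_ofNat, inv_mul_cancel₀ two_ne_zero,
    Real.rpow_one] at h3

end BddL2

namespace VecBddL2

variable {ι κ : Type*} {u v : ℕ → Ω → ι → ℝ}

theorem add (hu : VecBddL2 μ u) (hv : VecBddL2 μ v) : VecBddL2 μ (fun k ω => u k ω + v k ω) :=
  fun p => (hu p).add (hv p)

theorem sub (hu : VecBddL2 μ u) (hv : VecBddL2 μ v) : VecBddL2 μ (fun k ω => u k ω - v k ω) :=
  fun p => (hu p).sub (hv p)

theorem const_smul (hu : VecBddL2 μ u) (c : ℝ) : VecBddL2 μ (fun k ω => c • u k ω) :=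
  fun p => (hu p).const_mul c

theorem sum (s : Finset κ) {f : κ → ℕ → Ω → ι → ℝ} (hf : ∀ i ∈ s, VecBddL2 μ (f i)) :
    VecBddL2 μ (fun k ω => ∑ i ∈ s, f i k ω) := by
  intro p
  simpa only [Finset.sum_apply] using BddL2.sum s fun i hi => hf i hi p

theorem shift (hu : VecBddL2 μ u) : VecBddL2 μ (fun k => u (k + 1)) := fun p => (hu p).shift

theorem dotProduct [Fintype ι] (hu : VecBddL2 μ u) (c : ι → ℝ) :
    BddL2 μ (fun k ω => c ⬝ᵥ u k ω) :=
  BddL2.sum _ fun i _ => (hu i).const_mul (c i)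

theorem mulVec [Fintype ι] (hu : VecBddL2 μ u) (M : Matrix κ ι ℝ) :
    VecBddL2 μ (fun k ω => M *ᵥ u k ω) :=
  fun p => hu.dotProduct (M p)

theorem of_smul {f : ℕ → Ω → ℝ} (hf : BddL2 μ f) (c : ι → ℝ) :
    VecBddL2 μ (fun k ω => f k ω • c) := by
  intro p
  simpa [mul_comm] using hf.const_mul (c p)

end VecBddL2

/-- Variation of constants. The truncated subtraction is harmless, since `j < k` in every summand.
-/
theorem recursion_eq_sum {ι : Type*} [Fintype ι] [DecidableEq ι] (M : Matrix ι ι ℝ)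
    (X U : ℕ → ι → ℝ) (hX : ∀ k, X (k + 1) = M *ᵥ X k + U k) (k : ℕ) :
    X k = (M ^ k) *ᵥ X 0 + ∑ j ∈ Finset.range k, (M ^ j) *ᵥ U (k - 1 - j) := by
  induction k with
  | zero => simp
  | succ k ih =>
    rw [hX, Finset.sum_range_succ', ih, Matrix.mulVec_add, Matrix.mulVec_mulVec, ← pow_succ',
      add_assoc]
    congr 1
    rw [pow_zero, one_mulVec, mulVec_sum]
    congr 1
    refine Finset.sum_congr rfl fun j _ => ?_
    rw [Matrix.mulVec_mulVec, ← pow_succ', show k + 1 - 1 - (j + 1) = k - 1 - j by omega]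

/-- A Schur stable linear system maps `L²` bounded inputs to `L²` bounded states. -/
theorem VecBddL2.of_recursion {ι : Type*} [Fintype ι] [DecidableEq ι] {M : Matrix ι ι ℝ}
    (hM : IsSchur M) {X U : ℕ → Ω → ι → ℝ} (hX0 : ∀ p, MemLp (fun ω => X 0 ω p) 2 μ)
    (hU : VecBddL2 μ U) (hX : ∀ k ω, X (k + 1) ω = M *ᵥ X k ω + U k ω) : VecBddL2 μ X := by
  intro p
  have hU1 : ∀ k q, MemLp (fun ω => U k ω q) 2 μ := fun k q => (hU q).1 k
  choose B hB using fun q => (hU q).2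
  have hmul : ∀ (c : ℝ) (f : Ω → ℝ), eLpNorm (fun ω => c * f ω) 2 μ = ‖c‖ₑ * eLpNorm f 2 μ :=
    fun c f => eLpNorm_const_smul c f 2 μ
  have hrep : ∀ k, (fun ω => X k ω p) = (∑ q, fun ω => (M ^ k) p q * X 0 ω q) +
      ∑ j ∈ Finset.range k, ∑ q, fun ω => (M ^ j) p q * U (k - 1 - j) ω q := by
    intro k
    funext ω
    rw [recursion_eq_sum M (fun k => X k ω) (fun k => U k ω) (fun k => hX k ω) k]
    simp [Matrix.mulVec, _root_.dotProduct]
  have hA : ∀ k, MemLp (∑ q, fun ω => (M ^ k) p q * X 0 ω q) 2 μ := fun k =>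
    memLp_finsetSum' _ fun q _ => (hX0 q).const_mul _
  have hC : ∀ k j, MemLp (∑ q, fun ω => (M ^ j) p q * U (k - 1 - j) ω q) 2 μ := fun k j =>
    memLp_finsetSum' _ fun q _ => (hU1 _ q).const_mul _
  have hD : ∀ k, MemLp (∑ j ∈ Finset.range k, ∑ q, fun ω => (M ^ j) p q * U (k - 1 - j) ω q) 2 μ :=
    fun k => memLp_finsetSum' _ fun j _ => hC k j
  set s : ι → ℝ≥0∞ := fun q => ∑' k : ℕ, ‖(M ^ k) p q‖ₑ with hs
  -- The bound comes from Minkowski's inequality alone: the summed impulse response times the bounds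
  -- on the initial state and the inputs.
  set T : ℝ≥0∞ := (∑ q, s q * eLpNorm (fun ω => X 0 ω q) 2 μ) + ∑ q, s q * B q with hT
  have hTtop : T ≠ ∞ := by
    refine ENNReal.add_ne_top.2 ⟨ENNReal.sum_ne_top.2 fun q _ => ?_,
      ENNReal.sum_ne_top.2 fun q _ => ?_⟩
    · exact ENNReal.mul_ne_top (hM.tsum_enorm_pow_ne_top p q) (hX0 q).eLpNorm_ne_top
    · exact ENNReal.mul_ne_top (hM.tsum_enorm_pow_ne_top p q) ENNReal.coe_ne_top
  refine ⟨fun k => ?_, T.toNNReal, fun k => ?_⟩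
  · simp only [hrep k]
    exact (hA k).add (hD k)
  · rw [ENNReal.coe_toNNReal hTtop]
    beta_reduce
    rw [hrep k]
    refine (eLpNorm_add_le (hA k).1 (hD k).1 (by norm_num)).trans (add_le_add ?_ ?_)
    · refine (eLpNorm_sum_le (fun q _ => ((hX0 q).const_mul _).1) (by norm_num)).trans
        (Finset.sum_le_sum fun q _ => ?_)
      rw [hmul]
      exact mul_le_mul_left (ENNReal.le_tsum k) _
    · refine (eLpNorm_sum_le (fun j _ => (hC k j).1) (by norm_num)).trans ?_
      calc ∑ j ∈ Finset.range k,
            eLpNorm (∑ q, fun ω => (M ^ j) p q * U (k - 1 - j) ω q) 2 μ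
          ≤ ∑ j ∈ Finset.range k, ∑ q, ‖(M ^ j) p q‖ₑ * B q := by
            refine Finset.sum_le_sum fun j _ => ?_
            refine (eLpNorm_sum_le (fun q _ => ((hU1 _ q).const_mul _).1) (by norm_num)).trans
              (Finset.sum_le_sum fun q _ => ?_)
            rw [hmul]
            exact mul_le_mul_right (hB q _) _
        _ = ∑ q, (∑ j ∈ Finset.range k, ‖(M ^ j) p q‖ₑ) * B q := by
            rw [Finset.sum_comm]
            simp only [Finset.sum_mul]
        _ ≤ ∑ q, s q * B q :=
            Finset.sum_le_sum fun q _ => mul_le_mul_left (ENNReal.sum_le_tsum _) _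

/-- A crude form of `2|ab| ≤ a² + b²` suffices; the variances are then bounded by second moments. -/
theorem abs_covariance_le [IsProbabilityMeasure μ] {X Y : Ω → ℝ} (hX : MemLp X 2 μ)
    (hY : MemLp Y 2 μ) :
    |covariance X Y μ| ≤ ∫ ω, X ω ^ 2 ∂μ + ∫ ω, Y ω ^ 2 ∂μ := by
  have hX' : MemLp (fun ω => X ω - ∫ x, X x ∂μ) 2 μ := hX.sub (memLp_const _)
  have hY' : MemLp (fun ω => Y ω - ∫ x, Y x ∂μ) 2 μ := hY.sub (memLp_const _)
  have h1 : |covariance X Y μ| ≤ variance X μ + variance Y μ := by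
    rw [covariance, variance_eq_integral hX.1.aemeasurable,
      variance_eq_integral hY.1.aemeasurable,
      ← integral_add hX'.integrable_sq hY'.integrable_sq]
    refine (abs_integral_le_integral_abs).trans (integral_mono ?_ ?_ fun ω => ?_)
    · exact (hX'.integrable_mul hY').abs
    · exact hX'.integrable_sq.add hY'.integrable_sq
    · simp only [abs_mul]
      nlinarith [sq_nonneg (|X ω - ∫ x, X x ∂μ| - |Y ω - ∫ x, Y x ∂μ|),
        sq_abs (X ω - ∫ x, X x ∂μ), sq_abs (Y ω - ∫ x, Y x ∂μ), sq_nonneg (X ω - ∫ x, X x ∂μ),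
        sq_nonneg (Y ω - ∫ x, Y x ∂μ)]
  exact h1.trans (add_le_add (variance_le_expectation_sq hX.1) (variance_le_expectation_sq hY.1))

theorem VecBddL2.isStableSignal [IsProbabilityMeasure μ] {n : ℕ} {X : ℕ → Ω → Fin n → ℝ}
    (hX : VecBddL2 μ X) : IsStableSignal μ X := by
  refine ⟨fun k p => (hX p).1 k, ?_⟩
  choose M hM using fun p => (hX p).exists_integral_sq_le
  have h0 : ∀ p, 0 ≤ M p := fun p => (integral_nonneg fun _ => sq_nonneg _).trans (hM p 0)
  refine ⟨(∑ p, M p) + ∑ p, M p, fun k p q => ?_⟩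
  refine (abs_covariance_le ((hX p).1 k) ((hX q).1 k)).trans (add_le_add ?_ ?_)
  · exact (hM p k).trans (Finset.single_le_sum (fun p _ => h0 p) (Finset.mem_univ p))
  · exact (hM q k).trans (Finset.single_le_sum (fun p _ => h0 p) (Finset.mem_univ q))

/-- Random vectors with a common Gaussian law form an `L²` bounded signal. -/
theorem VecBddL2.of_hasLaw {n : ℕ} {m : EuclideanSpace ℝ (Fin n)} {V : Matrix (Fin n) (Fin n) ℝ}
    {w : ℕ → Ω → Fin n → ℝ}
    (h : ∀ k, HasLaw (fun ω => WithLp.toLp 2 (w k ω)) (multivariateGaussian m V) μ) :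
    VecBddL2 μ w := by
  intro p
  let g : EuclideanSpace ℝ (Fin n) → ℝ := fun x => x p
  have hg : MemLp g 2 (multivariateGaussian m V) :=
    IsGaussian.memLp_dual _ (EuclideanSpace.proj (𝕜 := ℝ) p) 2 (by norm_num)
  have hg' : ∀ k, AEStronglyMeasurable g (μ.map fun ω => WithLp.toLp 2 (w k ω)) := fun k => by
    rw [(h k).map_eq]; exact hg.1
  refine ⟨fun k => ?_, (eLpNorm g 2 (multivariateGaussian m V)).toNNReal, fun k => ?_⟩
  · have := (memLp_map_measure_iff (p := 2) (hg' k) (h k).aemeasurable).1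
      (by rw [(h k).map_eq]; exact hg)
    exact this
  · rw [ENNReal.coe_toNNReal hg.eLpNorm_ne_top]
    have := eLpNorm_map_measure (p := 2) (hg' k) (h k).aemeasurable
    rw [(h k).map_eq] at this
    exact this.ge

end Bounded

/-! ### Rank-one perturbations and the local decomposition -/

section RankOne

/-- The matrix determinant lemma in adjugate form. -/
theorem det_sub_vecMulVec {R ι : Type*} [CommRing R] [IsDomain R] [Fintype ι] [DecidableEq ι]
    (A : Matrix ι ι R) (hA : A.det ≠ 0) (u v : ι → R) :
    (A - vecMulVec u v).det = A.det - v ⬝ᵥ (A.adjugate *ᵥ u) := by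
  rcases isEmpty_or_nonempty ι with h | h
  · simp [Matrix.det_isEmpty, _root_.dotProduct]
  have hcard : 1 ≤ Fintype.card ι := Fintype.card_pos
  -- The right side is a scalar matrix minus a rank-one matrix, so its determinant is a known
  -- characteristic polynomial evaluated at `det A`. Comparing determinants leaves a factor `det A ^
  -- (card ι - 1)` to cancel.
  have h1 : A.adjugate * (A - vecMulVec u v) =
      Matrix.scalar ι A.det - vecMulVec (A.adjugate *ᵥ u) v := by
    rw [Matrix.mul_sub, adjugate_mul, mul_vecMulVec, Matrix.smul_one_eq_diagonal]
    rfl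
  have h2 := congrArg Matrix.det h1
  rw [← Matrix.eval_charpoly, charpoly_vecMulVec, det_mul, det_adjugate] at h2
  simp only [eval_sub, eval_pow, eval_X, eval_smul, smul_eq_mul] at h2
  apply mul_left_cancel₀ (pow_ne_zero (Fintype.card ι - 1) hA)
  rw [h2, mul_sub, ← pow_succ, Nat.sub_add_cancel hcard, dotProduct_comm v, mul_comm]

variable {ι : Type*} [Fintype ι] [DecidableEq ι]

/-- The determinant lemma over `ℝ[X]`, applied to `XI - L`, whose determinant is monic and hence
nonzero. -/
theorem charpoly_add_vecMulVec (L : Matrix ι ι ℝ) (u β : ι → ℝ) :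
    (L + vecMulVec u β).charpoly =
      L.charpoly - ∑ p, C (β p) * ((charmatrix L).adjugate *ᵥ (fun i => C (u i))) p := by
  have h : charmatrix (L + vecMulVec u β) =
      charmatrix L - vecMulVec (fun i => C (u i)) (fun i => C (β i)) := by
    ext1 i j
    simp [charmatrix, vecMulVec_apply, sub_sub]
  rw [Matrix.charpoly, h, det_sub_vecMulVec _ L.charpoly_monic.ne_zero]
  rfl

/-- A solution of a Sylvester equation forced by a polynomial multiple of the characteristic
polynomial of `L`, together with its image under the output map `β`. -/
theorem exists_intertwiner {κ : Type*} [Fintype κ] [DecidableEq κ] (L : Matrix ι ι ℝ)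
    (u β : ι → ℝ) (A : Matrix κ κ ℝ) (c : κ → ℝ) (r : ℝ[X]) :
    ∃ T : Matrix ι κ ℝ,
      T * A = L * T + vecMulVec u (c ᵥ* aeval A (r * L.charpoly)) ∧
      β ᵥ* T = c ᵥ* aeval A (r * (L.charpoly - (L + vecMulVec u β).charpoly)) := by
  set a : ι → ℝ[X] := (charmatrix L).adjugate *ᵥ (fun i => C (u i)) with ha
  have ha1 : ∀ p, X * a p = (∑ i, C (L p i) * a i) + L.charpoly * C (u p) := by
    intro p
    have h1 : (charmatrix L *ᵥ a) p = L.charpoly * C (u p) := by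
      rw [ha, mulVec_mulVec, mul_adjugate, smul_mulVec, one_mulVec]
      rfl
    rw [← h1, charmatrix, sub_mulVec, Pi.sub_apply, scalar_apply, mulVec_diagonal]
    simp [mulVec, _root_.dotProduct]
  -- The vector `a` solves `(XI - L) a = χ_L u`. Substituting `A` for `X` turns this into the
  -- Sylvester equation, and `β · a` is the difference of the two characteristic polynomials.
  refine ⟨Matrix.of fun p => c ᵥ* aeval A (r * a p), ?_, ?_⟩
  · ext p q
    have h2 : aeval A (r * a p) * A =
        (∑ i, L p i • aeval A (r * a i)) + u p • aeval A (r * L.charpoly) := by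
      have h3 : aeval A (r * a p) * A = aeval A (r * (X * a p)) := by
        rw [mul_left_comm, mul_comm X, map_mul (aeval A) (r * a p), aeval_X]
      rw [h3, ha1, mul_add, map_add, Finset.mul_sum, map_sum]
      congr 1
      · refine Finset.sum_congr rfl fun i _ => ?_
        rw [mul_left_comm, map_mul, aeval_C, ← Algebra.smul_def]
      · rw [← mul_assoc, mul_comm _ (C (u p)), map_mul, aeval_C, ← Algebra.smul_def]
    have h4 : ((Matrix.of fun p => c ᵥ* aeval A (r * a p)) * A) p q =
        (c ᵥ* (aeval A (r * a p) * A)) q := by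
      rw [← vecMul_vecMul]
      rfl
    rw [h4, h2, vecMul_add, vecMul_sum]
    simp only [vecMul_smul, Pi.add_apply, Finset.sum_apply, Pi.smul_apply, smul_eq_mul,
      Matrix.add_apply, Matrix.mul_apply, Matrix.of_apply, vecMulVec_apply]
  · rw [charpoly_add_vecMulVec, sub_sub_cancel, ← ha, Finset.mul_sum, map_sum, vecMul_sum]
    have h5 : ∀ i, aeval A (r * (C (β i) * a i)) = β i • aeval A (r * a i) := fun i => by
      rw [mul_left_comm, map_mul, aeval_C, ← Algebra.smul_def]
    simp only [h5, vecMul_smul]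
    ext q
    simp only [Finset.sum_apply, Pi.smul_apply, smul_eq_mul]
    rfl

end RankOne

/-! ### The plant and the local filters -/

section Local

variable {Ω : Type*} [MeasurableSpace Ω] {μ : Measure Ω} {n m nu ns : ℕ}

theorem memLp_mulVec_state_zero {A : Matrix (Fin n) (Fin n) ℝ} {x0 : Ω → Fin n → ℝ}
    {w : ℕ → Ω → Fin n → ℝ} (hx0 : ∀ p, MemLp (fun ω => x0 ω p) 2 μ) (M : Matrix (Fin ns) (Fin n) ℝ)
    (p : Fin ns) : MemLp (fun ω => (M *ᵥ state A (x0 ω) (fun t => w t ω) 0) p) 2 μ := by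
  have : (fun ω => (M *ᵥ state A (x0 ω) (fun t => w t ω) 0) p) = fun ω => ∑ q, M p q * x0 ω q := rfl
  rw [this]
  exact memLp_finsetSum _ fun q _ => (hx0 q).const_mul _

theorem aeval_fromBlocks_diagonal {ι κ : Type*} [Fintype ι] [DecidableEq ι] [Fintype κ]
    [DecidableEq κ] (M : Matrix ι ι ℝ) (N : Matrix κ κ ℝ) (p : ℝ[X]) :
    aeval (fromBlocks M 0 0 N) p = fromBlocks (aeval M p) 0 0 (aeval N p) := by
  induction p using Polynomial.induction_on' with
  | add p q hp hq => simp [hp, hq, fromBlocks_add]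
  | monomial k a =>
    have hpow : (fromBlocks M 0 0 N) ^ k = fromBlocks (M ^ k) 0 0 (N ^ k) := by
      induction k with
      | zero => simp
      | succ k ih => rw [pow_succ, ih, fromBlocks_multiply]; simp [pow_succ]
    simp [aeval_monomial, hpow, ← Algebra.smul_def, fromBlocks_smul]

theorem aeval_conj {ι κ : Type*} [Fintype ι] [DecidableEq ι] [Fintype κ] [DecidableEq κ]
    {T : Matrix ι κ ℝ} {T' : Matrix κ ι ℝ} (h : T * T' = 1) (h' : T' * T = 1) (D : Matrix κ κ ℝ)
    (p : ℝ[X]) : aeval (T * D * T') p = T * aeval D p * T' := by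
  induction p using Polynomial.induction_on' with
  | add p q hp hq => simp [hp, hq, Matrix.mul_add, Matrix.add_mul]
  | monomial k a =>
    have hpow : (T * D * T') ^ k = T * D ^ k * T' := by
      induction k with
      | zero => simp [h]
      | succ k ih =>
        rw [pow_succ, ih, pow_succ]
        calc T * D ^ k * T' * (T * D * T') = T * D ^ k * (T' * T) * D * T' := by
              simp only [Matrix.mul_assoc]
          _ = T * (D ^ k * D) * T' := by rw [h', Matrix.mul_one, Matrix.mul_assoc T]
    simp [aeval_monomial, hpow, ← Algebra.smul_def]

/-- The characteristic polynomial of the unstable part of `A` removes the unstable modes of the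
state. -/
theorem vecBddL2_aeval_charpoly_state {A : Matrix (Fin n) (Fin n) ℝ}
    {Au : Matrix (Fin nu) (Fin nu) ℝ} {As : Matrix (Fin ns) (Fin ns) ℝ} (hsplit : IsSplit A Au As)
    {x0 : Ω → Fin n → ℝ} {w : ℕ → Ω → Fin n → ℝ} (hx0 : ∀ p, MemLp (fun ω => x0 ω p) 2 μ)
    (hw : VecBddL2 μ w) :
    VecBddL2 μ (fun k ω => aeval A Au.charpoly *ᵥ state A (x0 ω) (fun t => w t ω) k) := by
  obtain ⟨T, T', h, h', hA⟩ := hsplit.similar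
  -- `J` projects onto the stable coordinates and `J'` embeds them, so `J T' x` follows a recursion
  -- with matrix `As`.
  let J : Matrix (Fin ns) (Fin nu ⊕ Fin ns) ℝ := fromCols 0 1
  let J' : Matrix (Fin nu ⊕ Fin ns) (Fin ns) ℝ := fromRows 0 1
  have hJ : J * fromBlocks Au 0 0 As = As * J := by
    simp [J, fromCols_mul_fromBlocks, mul_fromCols]
  have hJA : J * T' * A = As * (J * T') := by
    calc J * T' * A = J * (T' * T) * fromBlocks Au 0 0 As * T' := by
          rw [hA]; simp only [Matrix.mul_assoc]
      _ = As * (J * T') := by rw [h', Matrix.mul_one, hJ, Matrix.mul_assoc]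
  have hs : VecBddL2 μ (fun k ω => (J * T') *ᵥ state A (x0 ω) (fun t => w t ω) k) := by
    refine VecBddL2.of_recursion hsplit.stable (memLp_mulVec_state_zero hx0 _)
      (hw.mulVec (J * T')) fun k ω => ?_
    rw [state, mulVec_add, mulVec_mulVec, mulVec_mulVec, hJA]
  -- Cayley-Hamilton kills the `Au` block, so the polynomial in `A` factors through the stable
  -- coordinates.
  have hp : aeval A Au.charpoly = T * J' * aeval As Au.charpoly * (J * T') := by
    have hblock : fromBlocks 0 0 0 (aeval As Au.charpoly) = J' * aeval As Au.charpoly * J := by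
      simp only [J, J', fromRows_mul, Matrix.zero_mul, Matrix.one_mul, mul_fromCols,
        Matrix.mul_zero, Matrix.mul_one]
      ext (i | i) (j | j) <;> simp
    rw [hA, aeval_conj h h', aeval_fromBlocks_diagonal, aeval_self_charpoly, hblock]
    simp only [Matrix.mul_assoc]
  have := hs.mulVec (T * J' * aeval As Au.charpoly)
  simp only [mulVec_mulVec] at this
  simp only [hp]
  exact this

/-- The feedback `-βᵀξ̂ᵢ` in the residual cancels the rank-one part of `S`. -/
theorem localEst_succ {Lam : Matrix (Fin n) (Fin n) ℝ} {β : Fin n → ℝ} (y : ℕ → Fin m → ℝ)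
    (k : ℕ) (i : Fin m) :
    localEst (sMatrix Lam β) β y (k + 1) i =
      Lam *ᵥ localEst (sMatrix Lam β) β y k i + y (k + 1) i • 1 := by
  rw [localEst, sMatrix]
  beta_reduce
  rw [add_mulVec, vecMulVec_mulVec, sub_smul, add_assoc]
  congr 1
  simp

theorem isCoprime_charpoly {ι κ : Type*} [Fintype ι] [DecidableEq ι] [Fintype κ] [DecidableEq κ]
    {L : Matrix ι ι ℝ} {M : Matrix κ κ ℝ} (hL : IsSchur L) (hM : ∀ z ∈ eigs M, 1 ≤ ‖z‖) :
    IsCoprime L.charpoly M.charpoly := by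
  rw [isCoprime_iff_aeval_ne_zero_of_isAlgClosed ℝ ℂ]
  intro z
  by_contra! hz
  exact absurd (hL z (mem_eigs_iff.2 hz.1)) (hM z (mem_eigs_iff.2 hz.2)).not_gt

/-- The local residuals are bounded, although the state and the measurements need not be. -/
theorem bddL2_residual {A : Matrix (Fin n) (Fin n) ℝ} {C : Matrix (Fin m) (Fin n) ℝ}
    {Au : Matrix (Fin nu) (Fin nu) ℝ} {As : Matrix (Fin ns) (Fin ns) ℝ} (hsplit : IsSplit A Au As)
    {x0 : Ω → Fin n → ℝ} {w : ℕ → Ω → Fin n → ℝ} {v : ℕ → Ω → Fin m → ℝ}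
    (hx0 : ∀ p, MemLp (fun ω => x0 ω p) 2 μ) (hw : VecBddL2 μ w) (hv : VecBddL2 μ v)
    {Lam : Matrix (Fin n) (Fin n) ℝ} {β : Fin n → ℝ} (hLam : IsSchur Lam)
    (hdvd : Au.charpoly ∣ (sMatrix Lam β).charpoly) (j : Fin m) :
    BddL2 μ (fun k ω => residual (sMatrix Lam β) β
      (output A C (x0 ω) (fun t => w t ω) (fun t => v t ω)) k j) := by
  obtain ⟨q, hq⟩ := hdvd
  -- The equation `T A = Λ T + 1 c` may have no solution, as `A` and `Λ` can share stable
  -- eigenvalues. The Bézout identity `r χ_Λ + b χ_{Au} = 1` splits `c`: the first part admits an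
  -- explicit `T`, the second sees only the bounded signal `χ_{Au}(A) x`.
  obtain ⟨r, b, hrb⟩ := isCoprime_charpoly hLam hsplit.unstable
  set c : Fin n → ℝ := C j ᵥ* A with hc
  obtain ⟨T, hT, hβT⟩ := exists_intertwiner Lam 1 β A c r
  set x : ℕ → Ω → Fin n → ℝ := fun k ω => state A (x0 ω) (fun t => w t ω) k with hx
  set ξ : ℕ → Ω → Fin n → ℝ := fun k ω => localEst (sMatrix Lam β) β
      (output A C (x0 ω) (fun t => w t ω) (fun t => v t ω)) k j with hξ
  -- The noise in `yⱼ(k+1)` once it is written in terms of `x(k)`; hence the shifted index of `v`.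
  set e : ℕ → Ω → ℝ := fun k ω => C j ⬝ᵥ w k ω + v (k + 1) ω j with he
  have hebdd : BddL2 μ e := (hw.dotProduct (C j)).add (hv j).shift
  have hxu := vecBddL2_aeval_charpoly_state hsplit hx0 hw
  have hxpoly : ∀ s : ℝ[X], BddL2 μ (fun k ω => c ⬝ᵥ (aeval A (s * Au.charpoly) *ᵥ x k ω)) := by
    intro s
    have := (hxu.mulVec (aeval A s)).dotProduct c
    simpa only [mulVec_mulVec, ← map_mul] using this
  have hy : ∀ k ω, output A C (x0 ω) (fun t => w t ω) (fun t => v t ω) (k + 1) j =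
      c ⬝ᵥ x k ω + e k ω := by
    intro k ω
    simp only [output, state, Pi.add_apply, mulVec_add, mulVec_mulVec, he, hx, hc, add_assoc]
    congr 1
  have hεbdd : VecBddL2 μ (fun k ω => ξ k ω - T *ᵥ x k ω) := by
    refine VecBddL2.of_recursion (M := Lam)
      (U := fun k ω => (c ⬝ᵥ (aeval A (b * Au.charpoly) *ᵥ x k ω) + e k ω) • 1 - T *ᵥ w k ω)
      hLam ?_ ((VecBddL2.of_smul ((hxpoly b).add hebdd) 1).sub (hw.mulVec T)) fun k ω => ?_
    · intro p
      have := (memLp_mulVec_state_zero (A := A) (w := w) hx0 T p).neg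
      simpa [hξ, localEst] using! this
    · have h1 : ξ (k + 1) ω = Lam *ᵥ ξ k ω + (c ⬝ᵥ x k ω + e k ω) • 1 := by
        rw [← hy]
        exact localEst_succ _ k j
      have h2 : T *ᵥ x (k + 1) ω = Lam *ᵥ (T *ᵥ x k ω) +
          (c ⬝ᵥ (aeval A (r * Lam.charpoly) *ᵥ x k ω)) • 1 + T *ᵥ w k ω := by
        simp only [hx, state]
        rw [mulVec_add, mulVec_mulVec, hT, add_mulVec, vecMulVec_mulVec, mulVec_mulVec,
          ← dotProduct_mulVec]
        simp
      have h3 : c ⬝ᵥ x k ω = c ⬝ᵥ (aeval A (r * Lam.charpoly) *ᵥ x k ω) +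
          c ⬝ᵥ (aeval A (b * Au.charpoly) *ᵥ x k ω) := by
        rw [← dotProduct_add, ← add_mulVec, ← map_add, hrb, map_one, one_mulVec]
      rw [h1, h2, mulVec_sub, h3]
      module
  have hfinal := (hebdd.sub (hεbdd.dotProduct β)).add (hxpoly (b + r * q))
  convert hfinal using 3 with k ω
  have h4 : residual (sMatrix Lam β) β
      (output A C (x0 ω) (fun t => w t ω) (fun t => v t ω)) k j =
      c ⬝ᵥ x k ω + e k ω - β ⬝ᵥ ξ k ω := by
    rw [← hy]
    rfl
  have h5 : c ⬝ᵥ x k ω = β ⬝ᵥ (T *ᵥ x k ω) +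
      c ⬝ᵥ (aeval A ((b + r * q) * Au.charpoly) *ᵥ x k ω) := by
    -- Here divisibility enters: `χ_S = χ_{Au} q` turns `r (χ_Λ - χ_S)` into `1` minus a multiple of
    -- `χ_{Au}`.
    have h6 : (1 : ℝ[X]) = r * (Lam.charpoly - (Lam + vecMulVec 1 β).charpoly) +
        (b + r * q) * Au.charpoly := by
      rw [← sMatrix, hq, ← hrb]
      ring
    rw [dotProduct_mulVec β, hβT, ← dotProduct_mulVec c, ← dotProduct_add, ← add_mulVec, ← map_add,
      ← h6, map_one, one_mulVec]
  rw [h4, dotProduct_sub]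
  linarith

/-- The fused local estimates reproduce the steady-state Kalman filter, whose error is bounded. -/
theorem vecBddL2_sum_localEst_sub_state {A : Matrix (Fin n) (Fin n) ℝ}
    {C : Matrix (Fin m) (Fin n) ℝ} {K : Matrix (Fin n) (Fin m) ℝ}
    {x0 : Ω → Fin n → ℝ} {w : ℕ → Ω → Fin n → ℝ} {v : ℕ → Ω → Fin m → ℝ}
    (hx0 : ∀ p, MemLp (fun ω => x0 ω p) 2 μ) (hw : VecBddL2 μ w) (hv : VecBddL2 μ v)
    {Lam : Matrix (Fin n) (Fin n) ℝ} {β : Fin n → ℝ} {F : Fin m → Matrix (Fin n) (Fin n) ℝ}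
    (hK : IsSchur (A - K * C * A)) (hF : ∀ i, F i * Lam = (A - K * C * A) * F i)
    (hF1 : ∀ i, F i *ᵥ 1 = fun p => K p i) :
    VecBddL2 μ (fun k ω => (∑ j, F j *ᵥ localEst (sMatrix Lam β) β
      (output A C (x0 ω) (fun t => w t ω) (fun t => v t ω)) k j)
        - state A (x0 ω) (fun t => w t ω) k) := by
  refine VecBddL2.of_recursion (M := A - K * C * A)
    (U := fun k ω => (K * C - 1) *ᵥ w k ω + K *ᵥ v (k + 1) ω) hK ?_
    ((hw.mulVec _).add (hv.shift.mulVec K)) fun k ω => ?_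
  · intro p
    have := (memLp_mulVec_state_zero (A := A) (w := w) hx0 1 p).neg
    simpa [localEst] using! this
  · set y := output A C (x0 ω) (fun t => w t ω) (fun t => v t ω) with hy
    set x := state A (x0 ω) (fun t => w t ω) with hx
    have h1 : ∑ j, F j *ᵥ localEst (sMatrix Lam β) β y (k + 1) j =
        (A - K * C * A) *ᵥ (∑ j, F j *ᵥ localEst (sMatrix Lam β) β y k j) + K *ᵥ y (k + 1) := by
      have hKy : K *ᵥ y (k + 1) = ∑ j, y (k + 1) j • (F j *ᵥ 1) := by
        ext p
        simp [hF1, mulVec, _root_.dotProduct, mul_comm]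
      rw [hKy, mulVec_sum, ← Finset.sum_add_distrib]
      refine Finset.sum_congr rfl fun j _ => ?_
      rw [localEst_succ, mulVec_add, mulVec_mulVec, hF, mulVec_mulVec, mulVec_smul]
    have h2 : y (k + 1) = C *ᵥ (A *ᵥ x k + w k ω) + v (k + 1) ω := rfl
    have h3 : x (k + 1) = A *ᵥ x k + w k ω := rfl
    rw [h1, h2, h3]
    simp only [mulVec_add, mulVec_sub, sub_mulVec, mulVec_mulVec, one_mulVec, Matrix.mul_assoc]
    abel

end Local

/-! ### The modified Riccati inequality -/

section Riccati

/-- For a complex eigenvector `a + ib`, the sum of the quadratic forms at `a` and `b` is multiplied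
by `|z|²` under `M`; the cross terms cancel even if `P` is not symmetric. -/
theorem isSchur_of_lyapunov {ι : Type*} [Fintype ι] [DecidableEq ι] {M P : Matrix ι ι ℝ}
    (hP : ∀ x : ι → ℝ, x ≠ 0 → 0 < x ⬝ᵥ P *ᵥ x)
    (h : ∀ x : ι → ℝ, x ≠ 0 → (M *ᵥ x) ⬝ᵥ P *ᵥ (M *ᵥ x) < x ⬝ᵥ P *ᵥ x) : IsSchur M := by
  intro z hz
  rw [mem_eigs_iff, ← eval_map_algebraMap, ← Matrix.charpoly_map, eval_charpoly,
    ← exists_mulVec_eq_zero_iff] at hz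
  obtain ⟨v, hv0, hv⟩ := hz
  have hv' : ∀ i, ∑ j, (M i j : ℂ) * v j = z * v i := by
    intro i
    have h1 := congrFun hv i
    rw [sub_mulVec, scalar_apply, Pi.sub_apply, mulVec_diagonal, Pi.zero_apply, sub_eq_zero] at h1
    exact h1.symm
  set a : ι → ℝ := fun i => (v i).re with ha
  set b : ι → ℝ := fun i => (v i).im with hb
  have hMa : M *ᵥ a = z.re • a - z.im • b := by
    ext i
    have := congrArg Complex.re (hv' i)
    simpa [mulVec, _root_.dotProduct, ha, hb] using this
  have hMb : M *ᵥ b = z.im • a + z.re • b := by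
    ext i
    have := congrArg Complex.im (hv' i)
    simpa [mulVec, _root_.dotProduct, ha, hb, add_comm] using this
  have hab : a ≠ 0 ∨ b ≠ 0 := by
    by_contra! hab
    apply hv0
    ext i
    exact Complex.ext (congrFun hab.1 i) (congrFun hab.2 i)
  have hle : ∀ x : ι → ℝ, 0 ≤ x ⬝ᵥ P *ᵥ x := fun x => by
    by_cases hx : x = 0
    · simp [hx]
    · exact (hP x hx).le
  have hle' : ∀ x : ι → ℝ, (M *ᵥ x) ⬝ᵥ P *ᵥ (M *ᵥ x) ≤ x ⬝ᵥ P *ᵥ x := fun x => by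
    by_cases hx : x = 0
    · simp [hx]
    · exact (h x hx).le
  have hid : (M *ᵥ a) ⬝ᵥ P *ᵥ (M *ᵥ a) + (M *ᵥ b) ⬝ᵥ P *ᵥ (M *ᵥ b) =
      (z.re ^ 2 + z.im ^ 2) * (a ⬝ᵥ P *ᵥ a + b ⬝ᵥ P *ᵥ b) := by
    rw [hMa, hMb]
    simp only [mulVec_add, mulVec_sub, mulVec_smul, dotProduct_add, dotProduct_sub, add_dotProduct,
      sub_dotProduct, smul_dotProduct, dotProduct_smul, smul_eq_mul]
    ring
  have hlt : (M *ᵥ a) ⬝ᵥ P *ᵥ (M *ᵥ a) + (M *ᵥ b) ⬝ᵥ P *ᵥ (M *ᵥ b) <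
      a ⬝ᵥ P *ᵥ a + b ⬝ᵥ P *ᵥ b := by
    rcases hab with h0 | h0
    · exact add_lt_add_of_lt_of_le (h a h0) (hle' b)
    · exact add_lt_add_of_le_of_lt (hle' a) (h b h0)
  have hpos : 0 < a ⬝ᵥ P *ᵥ a + b ⬝ᵥ P *ᵥ b := by
    rcases hab with h0 | h0
    · exact add_pos_of_pos_of_nonneg (hP a h0) (hle b)
    · exact add_pos_of_nonneg_of_pos (hle a) (hP b h0)
  rw [hid] at hlt
  have hz1 : z.re ^ 2 + z.im ^ 2 < 1 := by
    by_contra! hge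
    nlinarith
  have hnorm : ‖z‖ ^ 2 < 1 := by
    rw [Complex.sq_norm, Complex.normSq_apply]
    nlinarith
  nlinarith [norm_nonneg z]

/-- The consensus gain stabilizes every nontrivial mode of the network. -/
theorem isSchur_sub_consensusGain {n : ℕ} (hn : (1 : Fin n → ℝ) ≠ 0)
    {S Pc : Matrix (Fin n) (Fin n) ℝ} {ζ : ℝ}
    (hPc : RiccatiInequality S Pc ζ) {μ₂ μₘ l : ℝ} (hl : (1 - l * (2 / (μ₂ + μₘ))) ^ 2 ≤ ζ ^ 2) :
    IsSchur (S - l • vecMulVec 1 (consensusGain S Pc μ₂ μₘ)) := by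
  obtain ⟨hP, hR⟩ := hPc
  have hPpos : ∀ x : Fin n → ℝ, x ≠ 0 → 0 < x ⬝ᵥ Pc *ᵥ x := fun x hx => by
    simpa using hP.dotProduct_mulVec_pos hx
  refine isSchur_of_lyapunov hPpos fun x hx => ?_
  set b : ℝ := (1 : Fin n → ℝ) ⬝ᵥ Pc *ᵥ 1 with hb
  have hb0 : 0 < b := hPpos 1 hn
  set c : ℝ := 2 / (μ₂ + μₘ) with hc
  set t : ℝ := (1 : Fin n → ℝ) ⬝ᵥ Pc *ᵥ (S *ᵥ x) with ht
  have hsymm : ∀ y z : Fin n → ℝ, y ⬝ᵥ Pc *ᵥ z = z ⬝ᵥ Pc *ᵥ y := fun y z => by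
    have hPt : Pcᵀ = Pc := by simpa using! hP.1
    rw [dotProduct_mulVec, ← mulVec_transpose, hPt, dotProduct_comm]
  have hΓ : consensusGain S Pc μ₂ μₘ ⬝ᵥ x = c / b * t := by
    rw [consensusGain, smul_dotProduct, ← dotProduct_mulVec, ← mulVec_mulVec, smul_eq_mul]
  have hMx : (S - l • vecMulVec 1 (consensusGain S Pc μ₂ μₘ)) *ᵥ x =
      S *ᵥ x - (l * (c / b * t)) • 1 := by
    rw [sub_mulVec, smul_mulVec, vecMulVec_mulVec, hΓ]
    ext i
    simp [div_eq_mul_inv]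
  have hRx := hR.dotProduct_mulVec_pos hx
  have hexp : star x ⬝ᵥ (Pc - Sᵀ * Pc * S + ((1 - ζ ^ 2) / b) •
      vecMulVec ((Sᵀ * Pc) *ᵥ 1) (1 ᵥ* (Pc * S))) *ᵥ x =
      x ⬝ᵥ Pc *ᵥ x - (S *ᵥ x) ⬝ᵥ Pc *ᵥ (S *ᵥ x) + (1 - ζ ^ 2) / b * (t * t) := by
    have h1 : x ⬝ᵥ (Sᵀ * Pc * S) *ᵥ x = (S *ᵥ x) ⬝ᵥ Pc *ᵥ (S *ᵥ x) := by
      rw [← mulVec_mulVec, ← mulVec_mulVec, dotProduct_mulVec, vecMul_transpose]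
    have h2 : x ⬝ᵥ (Sᵀ * Pc) *ᵥ 1 = t := by
      rw [← mulVec_mulVec, dotProduct_mulVec, vecMul_transpose, hsymm]
    have h3 : (1 ᵥ* (Pc * S)) ⬝ᵥ x = t := by
      rw [← dotProduct_mulVec, ← mulVec_mulVec]
    rw [add_mulVec, sub_mulVec, smul_mulVec, vecMulVec_mulVec, dotProduct_add, dotProduct_sub,
      dotProduct_smul, star_trivial, h1, h3]
    simp [h2]
  rw [hexp] at hRx
  -- With `t = 1ᵀ Pc S x`, the gain lowers the form by `(1 - (1 - lc)²) t² / b`, at least the `(1 -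
  -- ζ²) t² / b` that the Riccati inequality requires.
  have hMq : (S *ᵥ x - (l * (c / b * t)) • 1) ⬝ᵥ Pc *ᵥ (S *ᵥ x - (l * (c / b * t)) • 1) =
      (S *ᵥ x) ⬝ᵥ Pc *ᵥ (S *ᵥ x) - (1 - (1 - l * c) ^ 2) / b * (t * t) := by
    simp only [mulVec_sub, mulVec_smul, dotProduct_sub, sub_dotProduct,
      smul_dotProduct, dotProduct_smul, smul_eq_mul, hsymm (S *ᵥ x) 1, ← ht, ← hb]
    field_simp
    ring
  rw [hMx, hMq]
  have hcmp : (1 - ζ ^ 2) / b * (t * t) ≤ (1 - (1 - l * c) ^ 2) / b * (t * t) := by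
    gcongr
    exact mul_self_nonneg t
  linarith

end Riccati

/-! ### The network -/

namespace WeightedGraph

variable {m : ℕ} (G : WeightedGraph m)

theorem laplacian_mulVec_apply (x : Fin m → ℝ) (i : Fin m) :
    (G.laplacian *ᵥ x) i = ∑ l, G.adj i l * (x i - x l) := by
  rw [laplacian, sub_mulVec, Pi.sub_apply, mulVec_diagonal]
  simp [mulVec, _root_.dotProduct, Finset.sum_mul, mul_sub]

theorem dotProduct_laplacian_mulVec (x : Fin m → ℝ) :
    2 * (x ⬝ᵥ G.laplacian *ᵥ x) = ∑ i, ∑ l, G.adj i l * (x i - x l) ^ 2 := by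
  have h1 : x ⬝ᵥ G.laplacian *ᵥ x = ∑ i, ∑ l, G.adj i l * (x i * (x i - x l)) := by
    simp only [_root_.dotProduct, laplacian_mulVec_apply, Finset.mul_sum]
    exact Finset.sum_congr rfl fun i _ => Finset.sum_congr rfl fun l _ => by ring
  have h2 : x ⬝ᵥ G.laplacian *ᵥ x = ∑ i, ∑ l, G.adj i l * (x l * (x l - x i)) := by
    rw [h1, Finset.sum_comm]
    exact Finset.sum_congr rfl fun i _ => Finset.sum_congr rfl fun l _ => by rw [G.symm]
  rw [two_mul]
  nth_rewrite 1 [h1]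
  rw [h2, ← Finset.sum_add_distrib]
  refine Finset.sum_congr rfl fun i _ => ?_
  rw [← Finset.sum_add_distrib]
  exact Finset.sum_congr rfl fun l _ => by ring

theorem dotProduct_laplacian_mulVec_nonneg (x : Fin m → ℝ) : 0 ≤ x ⬝ᵥ G.laplacian *ᵥ x := by
  have h := G.dotProduct_laplacian_mulVec x
  have : 0 ≤ ∑ i, ∑ l, G.adj i l * (x i - x l) ^ 2 := Finset.sum_nonneg fun i _ =>
    Finset.sum_nonneg fun l _ => mul_nonneg (G.nonneg i l) (sq_nonneg _)
  linarith

theorem laplacian_mulVec_one : G.laplacian *ᵥ 1 = 0 := by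
  ext i
  simp [laplacian_mulVec_apply]

/-- The quadratic form is a sum of nonnegative edge terms, so its vanishing forces equality across
each edge, and then along walks. -/
theorem eq_of_laplacian_mulVec_eq_zero (hG : G.toSimpleGraph.Connected) {x : Fin m → ℝ}
    (hx : G.laplacian *ᵥ x = 0) (i j : Fin m) : x i = x j := by
  have h0 := G.dotProduct_laplacian_mulVec x
  rw [hx, dotProduct_zero, mul_zero, eq_comm, Finset.sum_eq_zero_iff_of_nonneg (fun i _ =>
    Finset.sum_nonneg fun l _ => mul_nonneg (G.nonneg i l) (sq_nonneg _))] at h0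
  have hterm : ∀ i l, G.adj i l * (x i - x l) ^ 2 = 0 := fun i l => by
    have := h0 i (Finset.mem_univ i)
    rw [Finset.sum_eq_zero_iff_of_nonneg (fun l _ => mul_nonneg (G.nonneg i l) (sq_nonneg _))]
      at this
    exact this l (Finset.mem_univ l)
  have hadj : ∀ i l, 0 < G.adj i l → x i = x l := fun i l hil => by
    have := (mul_eq_zero.1 (hterm i l)).resolve_left hil.ne'
    exact sub_eq_zero.1 (pow_eq_zero_iff two_ne_zero |>.1 this)
  obtain ⟨p⟩ := hG.preconnected i j
  induction p with
  | nil => rfl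
  | cons hab _ ih =>
    rw [toSimpleGraph, SimpleGraph.fromRel_adj] at hab
    rw [← ih]
    rcases hab.2 with h | h
    · exact hadj _ _ h
    · exact (hadj _ _ h).symm

theorem eigenvalues_nonneg (p : Fin m) : 0 ≤ G.laplacian_isHermitian.eigenvalues p := by
  set u := G.laplacian_isHermitian.eigenvectorBasis p with hu
  have h1 := G.laplacian_isHermitian.mulVec_eigenvectorBasis p
  have h2 := G.dotProduct_laplacian_mulVec_nonneg u
  rw [h1, dotProduct_smul, smul_eq_mul, ← hu] at h2
  have h3 : (u : Fin m → ℝ) ⬝ᵥ u = 1 := by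
    have : inner ℝ u u = 1 := by
      rw [real_inner_self_eq_norm_sq, hu, OrthonormalBasis.norm_eq_one, one_pow]
    rw [PiLp.inner_apply] at this
    exact this
  rwa [h3, mul_one] at h2

/-- Some Laplacian eigenvalue vanishes. -/
theorem exists_eigenvalue_eq_zero (hm : 0 < m) :
    ∃ p, G.laplacian_isHermitian.eigenvalues p = 0 := by
  by_contra! hne
  -- Were all eigenvalues nonzero, `1`, lying in the kernel, would be orthogonal to the whole
  -- eigenbasis.
  have horth : ∀ p, inner ℝ (G.laplacian_isHermitian.eigenvectorBasis p)
      (WithLp.toLp 2 (1 : Fin m → ℝ)) = 0 := by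
    intro p
    set u := G.laplacian_isHermitian.eigenvectorBasis p with hu
    have h1 := G.laplacian_isHermitian.mulVec_eigenvectorBasis p
    have hsymm : (G.laplacian)ᵀ = G.laplacian := by simpa using! G.laplacian_isHermitian
    have h2 : (1 : Fin m → ℝ) ⬝ᵥ G.laplacian *ᵥ u = 0 := by
      rw [dotProduct_mulVec, ← mulVec_transpose, hsymm, laplacian_mulVec_one, zero_dotProduct]
    rw [h1, dotProduct_smul, smul_eq_mul, ← hu] at h2
    have h3 := (mul_eq_zero.1 h2).resolve_left (hne p)
    simpa [PiLp.inner_apply, _root_.dotProduct] using h3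
  have h0 := G.laplacian_isHermitian.eigenvectorBasis.sum_repr' (WithLp.toLp 2 (1 : Fin m → ℝ))
  simp only [horth, zero_smul, Finset.sum_const_zero] at h0
  have := congrArg (fun x : EuclideanSpace ℝ (Fin m) => x ⟨0, hm⟩) h0
  simp at this

theorem μ₂_nonneg (hm : 2 ≤ m) : 0 ≤ G.μ₂ hm := by
  have := G.eigenvalues_nonneg ((Fintype.equivOfCardEq (Fintype.card_fin _))
    (Fin.cast (Fintype.card_fin m).symm (Fin.rev ⟨1, by omega⟩)))
  rw [Matrix.IsHermitian.eigenvalues, Equiv.symm_apply_apply] at this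
  exact this

theorem eigenvalues_le_μₘ (hm : 2 ≤ m) (p : Fin m) :
    G.laplacian_isHermitian.eigenvalues p ≤ G.μₘ hm := by
  apply G.laplacian_isHermitian.eigenvalues₀_antitone
  rw [Fin.le_def]
  simp [Fin.val_rev]
  omega

theorem μ₂_le_eigenvalues (hm : 2 ≤ m) {p : Fin m}
    (hp : 0 < G.laplacian_isHermitian.eigenvalues p) :
    G.μ₂ hm ≤ G.laplacian_isHermitian.eigenvalues p := by
  obtain ⟨q, hq⟩ := G.exists_eigenvalue_eq_zero (by omega)
  -- `eigenvalues₀` is decreasing, so a zero eigenvalue comes strictly after `p`. Thus `p` is not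
  -- last, and `μ₂` sits in the last position but one.
  have hlt : (Fintype.equivOfCardEq (Fintype.card_fin (Fintype.card (Fin m)))).symm p <
      (Fintype.equivOfCardEq (Fintype.card_fin (Fintype.card (Fin m)))).symm q := by
    by_contra! hle
    have := G.laplacian_isHermitian.eigenvalues₀_antitone hle
    change G.laplacian_isHermitian.eigenvalues p ≤ G.laplacian_isHermitian.eigenvalues q at this
    linarith
  apply G.laplacian_isHermitian.eigenvalues₀_antitone
  have hqlt := ((Fintype.equivOfCardEq (Fintype.card_fin (Fintype.card (Fin m)))).symm q).isLt
  rw [Fin.lt_def] at hlt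
  rw [Fin.le_def]
  simp only [Fin.val_cast, Fin.val_rev]
  have hcard := Fintype.card_fin m
  omega

/-- An eigenvector for the eigenvalue zero is a consensus vector. -/
theorem eigenvectorBasis_eq_of_eigenvalue_eq_zero (hG : G.toSimpleGraph.Connected) {p : Fin m}
    (hp : G.laplacian_isHermitian.eigenvalues p = 0) (i j : Fin m) :
    G.laplacian_isHermitian.eigenvectorBasis p i = G.laplacian_isHermitian.eigenvectorBasis p j :=
  G.eq_of_laplacian_mulVec_eq_zero hG
    (by rw [G.laplacian_isHermitian.mulVec_eigenvectorBasis p, hp, zero_smul]) i j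

/-- On `[μ₂, μₘ]` the quantity `|1 - 2l/(μ₂+μₘ)|` is largest at the endpoints, where it equals
`(μₘ-μ₂)/(μₘ+μ₂)`, the reciprocal of the eigenratio bound. -/
theorem sq_one_sub_le_of_inv_le_eigenratioBound (hm : 2 ≤ m) {ζ l : ℝ} (hζ : 0 < ζ)
    (hζ' : ENNReal.ofReal ζ⁻¹ ≤ G.eigenratioBound hm) (hl0 : 0 < l) (hl : G.μ₂ hm ≤ l)
    (hl' : l ≤ G.μₘ hm) : (1 - l * (2 / (G.μ₂ hm + G.μₘ hm))) ^ 2 ≤ ζ ^ 2 := by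
  have h2 := G.μ₂_nonneg hm
  rw [eigenratioBound] at hζ'
  set a := G.μ₂ hm
  set b := G.μₘ hm
  have hb : 0 < b := by linarith
  have hab : 0 < a + b := by linarith
  have heq : 1 - l * (2 / (a + b)) = (a + b - 2 * l) / (a + b) := by field_simp
  have habs : |1 - l * (2 / (a + b))| ≤ (b - a) / (a + b) := by
    rw [heq, abs_div, abs_of_pos hab]
    gcongr
    rw [abs_le]
    constructor <;> linarith
  have hle : (b - a) / (a + b) ≤ ζ := by
    -- If `μ₂ = μₘ` the bound is infinite and constrains nothing, but the left side is then zero.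
    rcases (hl.trans hl').eq_or_lt with h | h
    · rw [h, sub_self, zero_div]
      exact hζ.le
    · have hr : 0 < 1 - a / b := by rw [sub_pos, div_lt_one hb]; exact h
      rw [← ENNReal.ofReal_div_of_pos hr, ENNReal.ofReal_le_ofReal_iff (by positivity)] at hζ'
      have h3 : (1 + a / b) / (1 - a / b) = (a + b) / (b - a) := by
        have : b - a ≠ 0 := by linarith
        field_simp
        ring
      rw [h3] at hζ'
      have h4 := inv_anti₀ (inv_pos.2 hζ) hζ'
      rwa [inv_inv, inv_div] at h4
  rw [← sq_abs]
  exact pow_le_pow_left₀ (abs_nonneg _) (habs.trans hle) 2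

end WeightedGraph

theorem one_le_unstableProd {ι : Type*} [Fintype ι] [DecidableEq ι] (M : Matrix ι ι ℝ) :
    1 ≤ unstableProd M := by
  apply Multiset.one_le_prod
  intro x hx
  obtain ⟨z, hz, rfl⟩ := Multiset.mem_map.1 hx
  exact (Multiset.mem_filter.1 hz).2

/-! ### The consensus layer -/

section Consensus

variable {n m : ℕ} (G : WeightedGraph m)

theorem consensus_succ (S : Matrix (Fin n) (Fin n) ℝ) (β Γ : Fin n → ℝ) (y : ℕ → Fin m → ℝ)
    (k : ℕ) (i j : Fin m) :
    consensus G S β Γ y (k + 1) i j = S *ᵥ consensus G S β Γ y k i j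
      + (if j = i then residual S β y k i else 0) • 1
      - ((G.laplacian *ᵥ fun l => Γ ⬝ᵥ consensus G S β Γ y k l j) i) • 1 := by
  rw [consensus, sub_eq_add_neg, ← neg_smul, G.laplacian_mulVec_apply, ← Finset.sum_neg_distrib]
  simp only [message, ← mul_neg, neg_sub]

/-- The network modes of the consensus states evolve independently. -/
theorem sum_smul_consensus_succ (S : Matrix (Fin n) (Fin n) ℝ) (β Γ : Fin n → ℝ)
    (y : ℕ → Fin m → ℝ) {u : Fin m → ℝ} {l : ℝ} (hu : G.laplacian *ᵥ u = l • u) (k : ℕ)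
    (j : Fin m) :
    ∑ i, u i • consensus G S β Γ y (k + 1) i j =
      (S - l • vecMulVec 1 Γ) *ᵥ (∑ i, u i • consensus G S β Γ y k i j)
        + residual S β y k j • (u j • 1) := by
  have hsymm : (G.laplacian)ᵀ = G.laplacian := by simpa using! G.laplacian_isHermitian
  have h1 : ∑ i, u i * (G.laplacian *ᵥ fun l => Γ ⬝ᵥ consensus G S β Γ y k l j) i =
      l * (Γ ⬝ᵥ ∑ i, u i • consensus G S β Γ y k i j) := by
    change u ⬝ᵥ (G.laplacian *ᵥ fun l => Γ ⬝ᵥ consensus G S β Γ y k l j) = _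
    rw [dotProduct_mulVec, ← mulVec_transpose, hsymm, hu, smul_dotProduct, dotProduct_sum,
      smul_eq_mul]
    simp only [dotProduct_smul, smul_eq_mul]
    rfl
  simp only [consensus_succ, smul_sub, smul_add, Finset.sum_sub_distrib, Finset.sum_add_distrib,
    smul_smul, ← Finset.sum_smul]
  rw [h1, sub_mulVec, mulVec_sum, smul_mulVec, vecMulVec_mulVec]
  simp only [mulVec_smul]
  ext p
  simp
  ring

/-- The network mode `u = 1`, with eigenvalue `0`, obeys the recursion of the local filter. -/
theorem sum_consensus (S : Matrix (Fin n) (Fin n) ℝ) (β Γ : Fin n → ℝ) (y : ℕ → Fin m → ℝ)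
    (k : ℕ) (j : Fin m) : ∑ i, consensus G S β Γ y k i j = localEst S β y k j := by
  induction k with
  | zero => simp [consensus, localEst]
  | succ k ih =>
    have h := sum_smul_consensus_succ G S β Γ y (u := 1) (l := 0)
      (by rw [G.laplacian_mulVec_one, zero_smul]) k j
    simp only [Pi.one_apply, one_smul, zero_smul, sub_zero, ih] at h
    rw [h, localEst]
    rfl

/-- Expansion in an orthonormal basis. The coefficient of a mode vanishes when its basis vector is
constant, which removes the modes that the coupling cannot stabilize. -/
theorem disagreement_eq_sum_modes (b : OrthonormalBasis (Fin m) ℝ (EuclideanSpace ℝ (Fin m)))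
    (f : Fin m → Fin n → ℝ) (i : Fin m) :
    (m : ℝ) • f i - ∑ l, f l = ∑ p, ((m : ℝ) * b p i - ∑ l, b p l) • ∑ l, b p l • f l := by
  have hrep : ∀ i, f i = ∑ p, b p i • ∑ l, b p l • f l := by
    intro i
    ext q
    have h := congrArg (fun x : EuclideanSpace ℝ (Fin m) => x i)
      (b.sum_repr' (WithLp.toLp 2 fun l => f l q))
    simp only [WithLp.ofLp_sum, WithLp.ofLp_smul, Finset.sum_apply, Pi.smul_apply, smul_eq_mul,
      PiLp.inner_apply] at h
    simp only [Finset.sum_apply, Pi.smul_apply, smul_eq_mul]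
    rw [← h]
    refine Finset.sum_congr rfl fun p _ => ?_
    rw [mul_comm]
    congr 1
    exact Finset.sum_congr rfl fun l _ => by simp [mul_comm]
  have hsum : ∑ l, f l = ∑ p, (∑ l, b p l) • ∑ l, b p l • f l := by
    conv_lhs => rw [Finset.sum_congr rfl fun l _ => hrep l]
    rw [Finset.sum_comm]
    simp only [Finset.sum_smul]
  conv_lhs => rw [hrep i, hsum]
  rw [Finset.smul_sum, ← Finset.sum_sub_distrib]
  simp only [sub_smul, mul_smul]

variable {Ω : Type*} [MeasurableSpace Ω] {μ : Measure Ω}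

/-- If the consensus gain stabilizes the nontrivial network modes and the residuals are bounded,
then the disagreement between the sensors is bounded. -/
theorem vecBddL2_disagreement (hG : G.toSimpleGraph.Connected) {S : Matrix (Fin n) (Fin n) ℝ}
    {β Γ : Fin n → ℝ} {y : Ω → ℕ → Fin m → ℝ} {j : Fin m}
    (hres : BddL2 μ (fun k ω => residual S β (y ω) k j))
    (hΓ : ∀ p, 0 < G.laplacian_isHermitian.eigenvalues p →
      IsSchur (S - G.laplacian_isHermitian.eigenvalues p • vecMulVec 1 Γ)) (i : Fin m) :
    VecBddL2 μ (fun k ω => (m : ℝ) • consensus G S β Γ (y ω) k i j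
      - localEst S β (y ω) k j) := by
  simp only [← sum_consensus G S β Γ]
  simp only [fun k ω => disagreement_eq_sum_modes G.laplacian_isHermitian.eigenvectorBasis
    (fun i => consensus G S β Γ (y ω) k i j) i]
  refine VecBddL2.sum _ fun p _ => ?_
  rcases (G.eigenvalues_nonneg p).eq_or_lt with h | h
  -- This mode evolves with `S` itself, which need not be stable, so it has to drop out.
  · have h0 : (m : ℝ) * G.laplacian_isHermitian.eigenvectorBasis p i
        - ∑ l, G.laplacian_isHermitian.eigenvectorBasis p l = 0 := by
      rw [Finset.sum_congr rfl fun l _ =>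
        G.eigenvectorBasis_eq_of_eigenvalue_eq_zero hG h.symm l i]
      simp
    simp only [h0, zero_smul]
    exact fun _ => BddL2.zero
  · refine VecBddL2.const_smul (VecBddL2.of_recursion (hΓ p h) ?_
      (VecBddL2.of_smul hres (G.laplacian_isHermitian.eigenvectorBasis p j • 1)) fun k ω => ?_) _
    · intro q
      simp [consensus]
    · exact sum_smul_consensus_succ G S β Γ (y ω)
        (G.laplacian_isHermitian.mulVec_eigenvectorBasis p) k j

end Consensus

end DKF

end

theorem mainTheorem2 {Ω : Type*} [MeasurableSpace Ω] (μ : Measure Ω) [IsProbabilityMeasure μ]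
    {n m nu ns : ℕ} (hm : 2 ≤ m)
    -- the plant, its noises, and the steady-state Kalman filter
    (A : Matrix (Fin n) (Fin n) ℝ) (C : Matrix (Fin m) (Fin n) ℝ)
    (Au : Matrix (Fin nu) (Fin nu) ℝ) (As : Matrix (Fin ns) (Fin ns) ℝ)
    (Sig Q : Matrix (Fin n) (Fin n) ℝ) (R : Matrix (Fin m) (Fin m) ℝ)
    (x0 : Ω → Fin n → ℝ) (w : ℕ → Ω → Fin n → ℝ) (v : ℕ → Ω → Fin m → ℝ)
    (hmodel : DKF.IsGaussianModel μ Sig Q R x0 w v)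
    (hobs : DKF.Observable A C)
    (hsplit : DKF.IsSplit A Au As)
    (P : Matrix (Fin n) (Fin n) ℝ) (hP : DKF.IsSteadyState A C Q R P)
    -- the local decomposition
    (Lam : Matrix (Fin n) (Fin n) ℝ) (β : Fin n → ℝ) (F : Fin m → Matrix (Fin n) (Fin n) ℝ)
    (hdec : DKF.IsDecomposition A Au C (DKF.kalmanGain C R P) Lam β F)
    (S : Matrix (Fin n) (Fin n) ℝ) (hS : S = DKF.sMatrix Lam β)
    -- the network
    (G : DKF.WeightedGraph m) (hG : G.toSimpleGraph.Connected)
    -- the Mahler measure condition and the design of the consensus gain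
    (hmahler : ENNReal.ofReal (DKF.unstableProd S) < G.eigenratioBound hm)
    (ζ : ℝ) (hζ : DKF.unstableProd S < ζ⁻¹)
    (hζ' : ENNReal.ofReal ζ⁻¹ ≤ G.eigenratioBound hm)
    (Pc : Matrix (Fin n) (Fin n) ℝ) (hPc : DKF.RiccatiInequality S Pc ζ)
    (Γ : Fin n → ℝ) (hΓ : Γ = DKF.consensusGain S Pc (G.μ₂ hm) (G.μₘ hm)) :
    ∀ i : Fin m, DKF.IsStableSignal μ (DKF.estError A C x0 w v G S β Γ F i) := by
  intro i
  have hx0 : ∀ p, MemLp (fun ω => x0 ω p) 2 μ := fun p =>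
    (DKF.VecBddL2.of_hasLaw (w := fun _ => x0) (fun _ => hmodel.law_x0) p).1 0
  have hw : DKF.VecBddL2 μ w := DKF.VecBddL2.of_hasLaw hmodel.law_w
  have hv : DKF.VecBddL2 μ v := DKF.VecBddL2.of_hasLaw hmodel.law_v
  -- `β ≠ 0` rules out `n = 0`.
  have hn : (1 : Fin n → ℝ) ≠ 0 := fun h => hdec.beta_ne <| by
    ext p
    exact absurd (congrFun h p) one_ne_zero
  have hζ0 : 0 < ζ := inv_pos.1 (one_pos.trans_le ((DKF.one_le_unstableProd S).trans hζ.le))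
  have hstab : ∀ p, 0 < G.laplacian_isHermitian.eigenvalues p →
      DKF.IsSchur (S - G.laplacian_isHermitian.eigenvalues p • vecMulVec 1 Γ) := fun p hp => by
    rw [hΓ]
    exact DKF.isSchur_sub_consensusGain hn hPc (G.sq_one_sub_le_of_inv_le_eigenratioBound hm hζ0 hζ'
      hp (G.μ₂_le_eigenvalues hm hp) (G.eigenvalues_le_μₘ hm p))
  subst hS
  have hdvd : Au.charpoly ∣ (DKF.sMatrix Lam β).charpoly := by
    obtain ⟨q, hq, -⟩ := hdec.s_charpoly
    exact ⟨q, hq⟩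
  have hdis : ∀ j, DKF.VecBddL2 μ _ := fun j =>
    (DKF.vecBddL2_disagreement G hG (DKF.bddL2_residual (C := C) hsplit hx0 hw hv hdec.lam_schur hdvd j)
      hstab i).mulVec (F j)
  have hkal := DKF.vecBddL2_sum_localEst_sub_state (C := C) (β := β) hx0 hw hv
    (hdec.lam_schur.congr_charpoly hdec.lam_charpoly) hdec.f_intertwine hdec.f_one
  have hsum := (DKF.VecBddL2.sum Finset.univ fun j _ => hdis j).add hkal
  apply DKF.VecBddL2.isStableSignal
  -- Adding and subtracting `∑ⱼ Fⱼ ξ̂ⱼ` separates disagreement from the Kalman error.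
  convert hsum using 3 with k ω
  rw [DKF.estError, DKF.fusedEst, Finset.smul_sum]
  simp only [mulVec_sub, mulVec_smul, Finset.sum_sub_distrib]
  abel
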